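/- **Fundamental theorem of Hopf polyads.** *Polyads.* A polyad $T=(D,\mathcal C,T,\mu,\eta)$ consists of a category $D$, categories $\mathcal C_i$ ($i$ an object of $D$), functors $T_a:\mathcal C_j\to\mathcal C_i$ ($a:j\to i$ in $D$), natural transformations $\mu_{a,b}:T_aT_b\to T_{ab}$ for composable $a,b$ and $\eta_i:1_{\mathcal C_i}\to T_i:=T_{\mathrm{id}_i}$, such that $\mu_{ab,c}(\mu_{a,b}T_c)=\mu_{a,bc}(T_a\mu_{b,c})$ and $\mu_{a,\mathrm{id}_j}(T_a\eta_j)=\mathrm{id}_{T_a}=\mu_{\mathrm{id}_i,a}(\eta_iT_a)$. In other words, $T$ is a lax functor from $D$ to the bicategory of categories. It is *of action type* if all $\mu_{a,b}$ and $\eta_i$ are isomorphisms, i.e. if it is a pseudofunctor. A *comonoidal polyad* is a polyad in which every $\mathcal C_i$ is monoidal, every $T_a$ is comonoidal (oplax monoidal) with structure $T_a^2(X,Y):T_a(X\otimes Y)\to T_aX\otimes T_aY$, $T_a^0:T_a\mathbb 1\to\mathbb 1$, and all $\mu_{a,b}$, $\eta_i$ are comonoidal natural transformations. It is *strong comonoidal*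 if all $T_a^2$ and $T_a^0$ are isomorphisms. It is a *left* (resp. *right*) *Hopf polyad* if for all $b:k\to j$, $a:j\to i$ in $D$, $X\in\mathcal C_j$, $Y\in\mathcal C_k$ the morphism $$(T_aX\otimes(\mu_{a,b})_Y)\,T_a^2(X,T_bY):T_a(X\otimes T_bY)\to T_aX\otimes T_{ab}Y$$ (resp. $((\mu_{a,b})_Y\otimes T_aX)\,T_a^2(T_bY,X):T_a(T_bY\otimes X)\to T_{ab}Y\otimes T_aX$) is an isomorphism. *r-exactness and transitivity.* A comonoidal polyad is *r-exact* if every $\mathcal C_i$ has coequalizers of reflexive pairs and all functors $T_a$, $X\otimes ?$ and $?\otimes X$ preserve them. It is *transitive* if for every $a:j\to i$ in $D$ the coalgebra $T_a(\mathbb 1)$ is transitive, i.e. the functor $T_a(\mathbb 1)\otimes ?:\mathcal C_i\to\mathcal C_i$ is conservative (reflects isomorphisms). *The lift.* Let $T$ be an r-exact comonoidal polyad. Its lift $\tilde T$ is the comonoidal polyad with source $D$ given as follows. The category $\tilde{\mathcal C}_i$ is the category of modules $(M,\rho)$ over the comonoidal monad $T_i$ on $\mathcal C_i$, with tensor product $(M,\rho)\otimes(M',\rho')=(M\otimes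 M',(\rho\otimes\rho')T_i^2(M,M'))$ and unit $(\mathbb 1,T_i^0)$. For $a:j\to i$, the functor $\tilde T_a=T_a\odot_{T_j}?:\tilde{\mathcal C}_j\to\tilde{\mathcal C}_i$ sends $(M,\rho)$ to the coequalizer of $T_a(\rho),(\mu_{a,\mathrm{id}_j})_M:T_aT_jM\rightrightarrows T_aM$, with the $T_i$-action induced by $\mu_{\mathrm{id}_i,a}$. The product, unit and comonoidal structure of $\tilde T$ are induced by those of $T$. **Theorem.** Let $T$ be an r-exact transitive comonoidal polyad which is a left Hopf polyad or a right Hopf polyad. Then its lift $\tilde T$ is a strong comonoidal polyad of action type; in other words, $\tilde T$ is a strong comonoidal pseudofunctor from $D$ to categories. -/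

import Mathlib

open CategoryTheory CategoryTheory.Limits MonoidalCategory

universe v₁ v₂ u₁ u₂

/-- A functor is *r-exact* if it preserves coequalizers of reflexive pairs. -/
abbrev RExact {C : Type u₁} {D : Type u₂} [Category.{v₂} C] [Category.{v₂} D] (F : C ⥤ D) : Prop :=
  Monad.PreservesColimitOfIsReflexivePair F

/-- A `D`-polyad on the family of categories `C`: functors `T_f`, products
`μ : T_g T_f ⟶ T_h` for composable `f : i ⟶ j`, `g : j ⟶ k` with `h = g ∘ f` (in Lean `f ≫ g = h`),
and units `η_i : 𝟭 ⟶ T_{𝟙 i}`. The composite `h` is kept as a parameter with a proof of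
`f ≫ g = h` (instead of being replaced by `f ≫ g`) so that the strict equalities
`T_{(hg)f} = T_{h(gf)}`, `T_{f ∘ 𝟙} = T_f = T_{𝟙 ∘ f}` used in the axioms need no transport. -/
structure Polyad (D : Type u₁) [Category.{v₁} D] (C : D → Type u₂) [∀ i, Category.{v₂} (C i)] where
  /-- the functors `T_f` -/
  map : ∀ {i j : D}, (i ⟶ j) → (C i ⥤ C j)
  /-- the products -/
  mul : ∀ {i j k : D} (f : i ⟶ j) (g : j ⟶ k) (h : i ⟶ k), f ≫ g = h → (map f ⋙ map g ⟶ map h)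
  /-- the units -/
  unit : ∀ i : D, 𝟭 (C i) ⟶ map (𝟙 i)
  mul_assoc : ∀ {i j k l : D} (f : i ⟶ j) (g : j ⟶ k) (h : k ⟶ l) (fg : i ⟶ k) (gh : j ⟶ l)
    (fgh : i ⟶ l) (hfg : f ≫ g = fg) (hgh : g ≫ h = gh) (h₁ : fg ≫ h = fgh) (h₂ : f ≫ gh = fgh)
    (X : C i),
    (map h).map ((mul f g fg hfg).app X) ≫ (mul fg h fgh h₁).app X =
      (mul g h gh hgh).app ((map f).obj X) ≫ (mul f gh fgh h₂).app X
  map_unit_mul : ∀ {i j : D} (f : i ⟶ j) (X : C i),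
    (map f).map ((unit i).app X) ≫ (mul (𝟙 i) f f (Category.id_comp f)).app X = 𝟙 ((map f).obj X)
  unit_mul : ∀ {i j : D} (f : i ⟶ j) (X : C i),
    (unit j).app ((map f).obj X) ≫ (mul f (𝟙 j) f (Category.comp_id f)).app X = 𝟙 ((map f).obj X)

namespace Polyad

variable {D : Type u₁} [Category.{v₁} D] {C : D → Type u₂} [∀ i, Category.{v₂} (C i)]

attribute [simp] map_unit_mul unit_mul

/-- A polyad is of *action type* if its products and units are isomorphisms. -/
def IsActionType (T : Polyad D C) : Prop :=
  (∀ {i j k : D} (f : i ⟶ j) (g : j ⟶ k) (h : i ⟶ k) (w : f ≫ g = h), IsIso (T.mul f g h w)) ∧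
    ∀ i : D, IsIso (T.unit i)

/-- A polyad is *r-exact* if the categories have reflexive coequalizers and the functors
preserve them. -/
class IsRExact (T : Polyad D C) : Prop where
  hasReflexiveCoequalizers : ∀ i : D, HasReflexiveCoequalizers (C i)
  rExact : ∀ {i j : D} (f : i ⟶ j), RExact (T.map f)

attribute [instance] IsRExact.hasReflexiveCoequalizers IsRExact.rExact

variable (T : Polyad D C)

/-- naturality of the product, in unfolded form -/
theorem mul_naturality {i j k : D} (f : i ⟶ j) (g : j ⟶ k) (h : i ⟶ k) (w : f ≫ g = h)
    {X Y : C i} (φ : X ⟶ Y) :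
    (T.map g).map ((T.map f).map φ) ≫ (T.mul f g h w).app Y =
      (T.mul f g h w).app X ≫ (T.map h).map φ :=
  (T.mul f g h w).naturality φ

/-- naturality of the unit, in unfolded form -/
theorem unit_naturality {i : D} {X Y : C i} (φ : X ⟶ Y) :
    φ ≫ (T.unit i).app Y = (T.unit i).app X ≫ (T.map (𝟙 i)).map φ :=
  (T.unit i).naturality φ


theorem mul_eqToHom {i j k : D} (f : i ⟶ j) (g : j ⟶ k) {h h' : i ⟶ k} (w : f ≫ g = h)
    (e : h = h') (X : C i) (p : (T.map h).toCatHom = (T.map h').toCatHom) :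
    (T.mul f g h w).app X ≫ (eqToHom p).toNatTrans.app X =
      (T.mul f g h' (w.trans e)).app X := by
  subst e
  exact Category.comp_id _

/-- A polyad regarded as a lax functor from its source to the bicategory of categories. -/
def toLaxFunctor : LaxFunctor (LocallyDiscrete D) Cat.{v₂, u₂} where
  obj i := Cat.of (C i.as)
  map f := (T.map f.as).toCatHom
  map₂ φ := eqToHom (by rw [LocallyDiscrete.eq_of_hom φ])
  mapId i := (T.unit i.as).toCatHom₂
  mapComp f g := (T.mul f.as g.as _ rfl).toCatHom₂
  map₂_id f := by simp
  map₂_comp φ ψ := by simp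
  mapComp_naturality_left {_ _ _ f f'} φ g := by
    obtain rfl := LocallyDiscrete.eq_of_hom φ
    ext X
    refine (Category.comp_id _).trans ?_
    refine Eq.trans ?_ (congrArg (· ≫ (T.mul f.as g.as _ rfl).app X)
      ((T.map g.as).map_id _)).symm
    exact (Category.id_comp _).symm
  mapComp_naturality_right {_ _ _} f {g g'} φ := by
    obtain rfl := LocallyDiscrete.eq_of_hom φ
    ext X
    exact (Category.comp_id _).trans (Category.id_comp _).symm
  map₂_associator {a b c d} f g h := by
    ext X
    have e := congrArg Discrete.as (LocallyDiscrete.eq_of_hom (Bicategory.associator f g h).hom)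
    refine Eq.trans (congrArg _ (T.mul_eqToHom _ _ rfl e X _)) ?_
    refine Eq.trans ?_ (Category.id_comp _).symm
    exact T.mul_assoc f.as g.as h.as _ _ _ rfl rfl e rfl X
  map₂_leftUnitor {a b} f := by
    ext X
    have e := congrArg Discrete.as (LocallyDiscrete.eq_of_hom (Bicategory.leftUnitor f).inv)
    refine Eq.trans ?_ (Category.id_comp _).symm
    refine Eq.trans ?_ (congrArg _ (T.mul_eqToHom _ _ (Category.id_comp f.as) e X
      (congrArg (fun m => (T.map m).toCatHom) e)))
    refine (Category.id_comp _).symm.trans ?_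
    refine (congrArg (· ≫ _) (T.map_unit_mul f.as X).symm).trans ?_
    exact Category.assoc _ _ _
  map₂_rightUnitor {a b} f := by
    ext X
    have e := congrArg Discrete.as (LocallyDiscrete.eq_of_hom (Bicategory.rightUnitor f).inv)
    refine Eq.trans ?_ (Category.id_comp _).symm
    refine Eq.trans ?_ (congrArg _ (T.mul_eqToHom _ _ (Category.comp_id f.as) e X
      (congrArg (fun m => (T.map m).toCatHom) e)))
    refine (Category.id_comp _).symm.trans ?_
    refine (congrArg (· ≫ _) (T.unit_mul f.as X).symm).trans ?_
    exact Category.assoc _ _ _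

/-- The monad `T_i = T_{𝟙 i}` on `C i`. -/
@[reducible] def monad (i : D) : Monad (C i) where
  toFunctor := T.map (𝟙 i)
  η := T.unit i
  μ := T.mul (𝟙 i) (𝟙 i) (𝟙 i) (Category.comp_id _)
  assoc _ := T.mul_assoc ..
  left_unit _ := T.unit_mul ..
  right_unit _ := T.map_unit_mul ..

/-- The category of `T_i`-modules. -/
abbrev LiftCat (i : D) : Type (max u₂ v₂) := (T.monad i).Algebra

section Lift

instance isReflexivePair {i j : D} (f : i ⟶ j) (X : T.LiftCat i) :
    IsReflexivePair ((T.map f).map X.a)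
      ((T.mul (𝟙 i) f f (Category.id_comp f)).app X.A) :=
  IsReflexivePair.mk' ((T.map f).map ((T.unit i).app X.A))
    (by rw [← Functor.map_comp]
        exact (congrArg _ X.unit).trans (CategoryTheory.Functor.map_id _ _))
    (T.map_unit_mul f X.A)

variable [T.IsRExact]

/-- The underlying object of `T_f ⊙_{T_i} X`: the coequalizer of `T_f T_i X ⇉ T_f X`, the two maps
being given by the action of `T_i` on `X` and by the product of `T`. -/
noncomputable def tensorObj {i j : D} (f : i ⟶ j) (X : T.LiftCat i) : C j :=
  coequalizer ((T.map f).map X.a) ((T.mul (𝟙 i) f f (Category.id_comp f)).app X.A)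

/-- The projection `T_f X ⟶ T_f ⊙_{T_i} X`. -/
noncomputable def proj {i j : D} (f : i ⟶ j) (X : T.LiftCat i) :
    (T.map f).obj X.A ⟶ T.tensorObj f X :=
  coequalizer.π _ _

theorem proj_condition {i j : D} (f : i ⟶ j) (X : T.LiftCat i) :
    (T.map f).map X.a ≫ T.proj f X =
      (T.mul (𝟙 i) f f (Category.id_comp f)).app X.A ≫ T.proj f X :=
  coequalizer.condition _ _

/-- Morphisms out of `T_f ⊙_{T_i} X`. -/
noncomputable def desc {i j : D} (f : i ⟶ j) (X : T.LiftCat i) {Z : C j}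
    (k : (T.map f).obj X.A ⟶ Z)
    (w : (T.map f).map X.a ≫ k = (T.mul (𝟙 i) f f (Category.id_comp f)).app X.A ≫ k) :
    T.tensorObj f X ⟶ Z :=
  coequalizer.desc k w

@[simp]
theorem proj_desc {i j : D} (f : i ⟶ j) (X : T.LiftCat i) {Z : C j}
    (k : (T.map f).obj X.A ⟶ Z)
    (w : (T.map f).map X.a ≫ k = (T.mul (𝟙 i) f f (Category.id_comp f)).app X.A ≫ k) :
    T.proj f X ≫ T.desc f X k w = k :=
  coequalizer.π_desc k w

instance epi_proj {i j : D} (f : i ⟶ j) (X : T.LiftCat i) : Epi (T.proj f X) :=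
  inferInstanceAs (Epi (coequalizer.π _ _))

/-- `T_g` preserves the coequalizer that defines `T_f ⊙_{T_i} X`. -/
noncomputable def isColimitMapProj {i j k : D} (f : i ⟶ j) (g : j ⟶ k) (X : T.LiftCat i) :
    IsColimit (Cofork.ofπ ((T.map g).map (T.proj f X))
      (f := (T.map g).map ((T.map f).map X.a))
      (g := (T.map g).map ((T.mul (𝟙 i) f f (Category.id_comp f)).app X.A))
      (by rw [← Functor.map_comp, proj_condition, Functor.map_comp])) :=
  isColimitOfHasCoequalizerOfPreservesColimit (T.map g)
    ((T.map f).map X.a) ((T.mul (𝟙 i) f f (Category.id_comp f)).app X.A)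

instance epi_map_proj {i j k : D} (f : i ⟶ j) (g : j ⟶ k) (X : T.LiftCat i) :
    Epi ((T.map g).map (T.proj f X)) :=
  Cofork.IsColimit.epi (T.isColimitMapProj f g X)

/-- Morphisms out of `T_g (T_f ⊙_{T_i} X)`. -/
noncomputable def mapDesc {i j k : D} (f : i ⟶ j) (g : j ⟶ k) (X : T.LiftCat i) {Z : C k}
    (m : (T.map g).obj ((T.map f).obj X.A) ⟶ Z)
    (w : (T.map g).map ((T.map f).map X.a) ≫ m =
      (T.map g).map ((T.mul (𝟙 i) f f (Category.id_comp f)).app X.A) ≫ m) :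
    (T.map g).obj (T.tensorObj f X) ⟶ Z :=
  (Cofork.IsColimit.desc' (T.isColimitMapProj f g X) m w).1

@[simp]
theorem map_proj_mapDesc {i j k : D} (f : i ⟶ j) (g : j ⟶ k) (X : T.LiftCat i) {Z : C k}
    (m : (T.map g).obj ((T.map f).obj X.A) ⟶ Z)
    (w : (T.map g).map ((T.map f).map X.a) ≫ m =
      (T.map g).map ((T.mul (𝟙 i) f f (Category.id_comp f)).app X.A) ≫ m) :
    (T.map g).map (T.proj f X) ≫ T.mapDesc f g X m w = m :=
  (Cofork.IsColimit.desc' (T.isColimitMapProj f g X) m w).2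

/-- The map `T_g (T_f ⊙ X) ⟶ T_h ⊙ X` induced by the product, for `h = g ∘ f`. -/
noncomputable def act {i j k : D} (f : i ⟶ j) (g : j ⟶ k) (h : i ⟶ k) (w : f ≫ g = h)
    (X : T.LiftCat i) : (T.map g).obj (T.tensorObj f X) ⟶ T.tensorObj h X :=
  T.mapDesc f g X ((T.mul f g h w).app X.A ≫ T.proj h X) (by
    rw [reassoc_of% T.mul_naturality, proj_condition,
      reassoc_of% T.mul_assoc (𝟙 i) f g f h h (Category.id_comp f) w w (Category.id_comp h)])

@[simp]
theorem map_proj_act {i j k : D} (f : i ⟶ j) (g : j ⟶ k) (h : i ⟶ k) (w : f ≫ g = h)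
    (X : T.LiftCat i) :
    (T.map g).map (T.proj f X) ≫ T.act f g h w X = (T.mul f g h w).app X.A ≫ T.proj h X :=
  T.map_proj_mapDesc ..

instance epi_map_map_proj {i j k l : D} (f : i ⟶ j) (g : j ⟶ k) (h : k ⟶ l) (X : T.LiftCat i) :
    Epi ((T.map h).map ((T.map g).map (T.proj f X))) := by
  have : IsReflexivePair ((T.map g).map ((T.map f).map X.a))
      ((T.map g).map ((T.mul (𝟙 i) f f (Category.id_comp f)).app X.A)) :=
    IsReflexivePair.mk' ((T.map g).map (commonSection ((T.map f).map X.a)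
      ((T.mul (𝟙 i) f f (Category.id_comp f)).app X.A)))
      (by rw [← Functor.map_comp, section_comp_left, CategoryTheory.Functor.map_id])
      (by rw [← Functor.map_comp, section_comp_right, CategoryTheory.Functor.map_id])
  exact Cofork.IsColimit.epi
    (isColimitCoforkMapOfIsColimit (T.map h) _ (T.isColimitMapProj f g X))

theorem mul_act {i j k l : D} (f : i ⟶ j) (g : j ⟶ k) (h : k ⟶ l) (fg : i ⟶ k) (gh : j ⟶ l)
    (fgh : i ⟶ l) (hfg : f ≫ g = fg) (hgh : g ≫ h = gh) (h₁ : fg ≫ h = fgh) (h₂ : f ≫ gh = fgh)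
    (X : T.LiftCat i) :
    (T.map h).map (T.act f g fg hfg X) ≫ T.act fg h fgh h₁ X =
      (T.mul g h gh hgh).app (T.tensorObj f X) ≫ T.act f gh fgh h₂ X := by
  rw [← cancel_epi ((T.map h).map ((T.map g).map (T.proj f X))), ← Functor.map_comp_assoc,
    map_proj_act, Functor.map_comp_assoc, map_proj_act, reassoc_of% T.mul_naturality, map_proj_act,
    reassoc_of% T.mul_assoc f g h fg gh fgh hfg hgh h₁ h₂]

@[simp]
theorem unit_act {i j : D} (f : i ⟶ j) (X : T.LiftCat i) :
    (T.unit j).app (T.tensorObj f X) ≫ T.act f (𝟙 j) f (Category.comp_id f) X =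
      𝟙 (T.tensorObj f X) := by
  rw [← cancel_epi (T.proj f X)]
  have h := (reassoc_of% (T.unit_naturality (T.proj f X))) (T.act f (𝟙 j) f (Category.comp_id f) X)
  rw [map_proj_act, reassoc_of% T.unit_mul] at h
  exact h.trans (Category.comp_id _).symm

/-- The `T_j`-module `T_f ⊙_{T_i} X`. -/
@[reducible] noncomputable def liftObj {i j : D} (f : i ⟶ j) (X : T.LiftCat i) : T.LiftCat j where
  A := T.tensorObj f X
  a := T.act f (𝟙 j) f (Category.comp_id f) X
  unit := T.unit_act f X
  assoc := (T.mul_act ..).symm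

/-- The morphism `T_f ⊙ X ⟶ T_f ⊙ Y` induced by a morphism of modules `X ⟶ Y`. -/
noncomputable def tensorMap {i j : D} (f : i ⟶ j) {X Y : T.LiftCat i} (φ : X ⟶ Y) :
    T.tensorObj f X ⟶ T.tensorObj f Y :=
  T.desc f X ((T.map f).map φ.f ≫ T.proj f Y) (by
    have h : (T.map (𝟙 i)).map φ.f ≫ Y.a = X.a ≫ φ.f := φ.h
    rw [← Functor.map_comp_assoc, ← h, Functor.map_comp_assoc, proj_condition,
      reassoc_of% T.mul_naturality])

@[simp]
theorem proj_tensorMap {i j : D} (f : i ⟶ j) {X Y : T.LiftCat i} (φ : X ⟶ Y) :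
    T.proj f X ≫ T.tensorMap f φ = (T.map f).map φ.f ≫ T.proj f Y :=
  T.proj_desc ..

theorem map_tensorMap_act {i j k : D} (f : i ⟶ j) (g : j ⟶ k) (h : i ⟶ k) (w : f ≫ g = h)
    {X Y : T.LiftCat i} (φ : X ⟶ Y) :
    (T.map g).map (T.tensorMap f φ) ≫ T.act f g h w Y =
      T.act f g h w X ≫ T.tensorMap h φ := by
  rw [← cancel_epi ((T.map g).map (T.proj f X)), ← Functor.map_comp_assoc, proj_tensorMap,
    Functor.map_comp_assoc, map_proj_act, reassoc_of% T.mul_naturality, reassoc_of% T.map_proj_act,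
    proj_tensorMap]

/-- The lifted functor `T_f ⊙_{T_i} ?` from `T_i`-modules to `T_j`-modules. -/
@[reducible] noncomputable def liftMap {i j : D} (f : i ⟶ j) : T.LiftCat i ⥤ T.LiftCat j where
  obj X := T.liftObj f X
  map {X Y} φ :=
    { f := T.tensorMap f φ
      h := T.map_tensorMap_act .. }
  map_id X := by
    ext
    refine (cancel_epi (T.proj f X)).1 ?_
    refine (T.proj_tensorMap f (𝟙 X)).trans ?_
    simp
  map_comp {X Y Z} φ ψ := by
    ext
    refine (cancel_epi (T.proj f X)).1 ?_
    refine (T.proj_tensorMap f (φ ≫ ψ)).trans ?_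
    simp [reassoc_of% T.proj_tensorMap]

/-- The underlying morphism `T_g ⊙ (T_f ⊙ X) ⟶ T_h ⊙ X` of the lifted product: the unique morphism
such that `T_g T_f X ⟶ T_g (T_f ⊙ X) ⟶ T_g ⊙ (T_f ⊙ X) ⟶ T_h ⊙ X` is
`T_g T_f X ⟶ T_h X ⟶ T_h ⊙ X`. -/
noncomputable def tensorMul {i j k : D} (f : i ⟶ j) (g : j ⟶ k) (h : i ⟶ k) (w : f ≫ g = h)
    (X : T.LiftCat i) : T.tensorObj g (T.liftObj f X) ⟶ T.tensorObj h X :=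
  T.desc g (T.liftObj f X) (T.act f g h w X) (T.mul_act ..)

@[simp]
theorem proj_tensorMul {i j k : D} (f : i ⟶ j) (g : j ⟶ k) (h : i ⟶ k) (w : f ≫ g = h)
    (X : T.LiftCat i) :
    T.proj g (T.liftObj f X) ≫ T.tensorMul f g h w X = T.act f g h w X :=
  T.proj_desc ..

theorem map_tensorMul_act {i j k l : D} (f : i ⟶ j) (g : j ⟶ k) (h : k ⟶ l) (fg : i ⟶ k)
    (gh : j ⟶ l) (fgh : i ⟶ l) (hfg : f ≫ g = fg) (hgh : g ≫ h = gh) (h₁ : fg ≫ h = fgh)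
    (h₂ : f ≫ gh = fgh) (X : T.LiftCat i) :
    (T.map h).map (T.tensorMul f g fg hfg X) ≫ T.act fg h fgh h₁ X =
      T.act g h gh hgh (T.liftObj f X) ≫ T.tensorMul f gh fgh h₂ X := by
  rw [← cancel_epi ((T.map h).map (T.proj g (T.liftObj f X))),
    ← Functor.map_comp_assoc, proj_tensorMul, reassoc_of% T.map_proj_act, proj_tensorMul]
  exact T.mul_act ..

/-- The lifted product. -/
noncomputable def liftMul {i j k : D} (f : i ⟶ j) (g : j ⟶ k) (h : i ⟶ k) (w : f ≫ g = h) :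
    T.liftMap f ⋙ T.liftMap g ⟶ T.liftMap h where
  app X :=
    { f := T.tensorMul f g h w X
      h := T.map_tensorMul_act .. }
  naturality X Y φ := by
    ext
    refine (cancel_epi (T.proj g (T.liftObj f X))).1 ?_
    refine ((reassoc_of% (T.proj_tensorMap g ((T.liftMap f).map φ))) _).trans ?_
    refine (congrArg _ (T.proj_tensorMul f g h w Y)).trans ?_
    refine (T.map_tensorMap_act f g h w φ).trans ?_
    exact ((reassoc_of% (T.proj_tensorMul f g h w X)) _).symm

/-- The lifted unit, `X ⟶ T_i X ⟶ T_i ⊙_{T_i} X`. -/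
noncomputable def liftUnit (i : D) : 𝟭 (T.LiftCat i) ⟶ T.liftMap (𝟙 i) where
  app X :=
    { f := (T.unit i).app X.A ≫ T.proj (𝟙 i) X
      h := by
        have h₁ : (T.map (𝟙 i)).map ((T.unit i).app X.A ≫ T.proj (𝟙 i) X) ≫
            T.act (𝟙 i) (𝟙 i) (𝟙 i) (Category.comp_id _) X = T.proj (𝟙 i) X := by
          rw [Functor.map_comp_assoc, map_proj_act]
          exact (reassoc_of% (T.map_unit_mul (𝟙 i) X.A)) _
        have h₂ : X.a ≫ (T.unit i).app X.A ≫ T.proj (𝟙 i) X = T.proj (𝟙 i) X := by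
          refine ((reassoc_of% (T.unit_naturality X.a)) _).trans ?_
          rw [proj_condition, reassoc_of% T.unit_mul]
        exact h₁.trans h₂.symm }
  naturality X Y φ := by
    ext
    refine ((reassoc_of% (T.unit_naturality φ.f)) _).trans ?_
    refine Eq.trans ?_ (Category.assoc _ _ _).symm
    exact congrArg _ (T.proj_tensorMap (𝟙 i) φ).symm

/-- The *lift* of an r-exact polyad. -/
@[reducible] noncomputable def lift : Polyad D T.LiftCat where
  map f := T.liftMap f
  mul f g h w := T.liftMul f g h w
  unit i := T.liftUnit i
  mul_assoc f g h fg gh fgh hfg hgh h₁ h₂ X := by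
    ext
    refine (cancel_epi (T.proj h (T.liftObj g (T.liftObj f X)))).1 ?_
    refine ((reassoc_of% (T.proj_tensorMap h ((T.liftMul f g fg hfg).app X))) _).trans ?_
    refine (congrArg _ (T.proj_tensorMul fg h fgh h₁ X)).trans ?_
    refine (T.map_tensorMul_act f g h fg gh fgh hfg hgh h₁ h₂ X).trans ?_
    exact ((reassoc_of% (T.proj_tensorMul g h gh hgh (T.liftObj f X))) _).symm
  map_unit_mul f X := by
    ext
    refine (cancel_epi (T.proj f X)).1 ?_
    refine ((reassoc_of% (T.proj_tensorMap f ((T.liftUnit _).app X))) _).trans ?_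
    refine (congrArg _ (T.proj_tensorMul _ f f (Category.id_comp f) X)).trans ?_
    refine (Functor.map_comp_assoc _ _ _ _).trans ?_
    refine (congrArg _ (T.map_proj_act _ f f (Category.id_comp f) X)).trans ?_
    refine ((reassoc_of% (T.map_unit_mul f X.A)) _).trans ?_
    exact (Category.comp_id _).symm
  unit_mul {i j} f X := by
    ext
    refine (Category.assoc _ _ _).trans ?_
    refine (congrArg _ (T.proj_tensorMul f _ f (Category.comp_id f) X)).trans ?_
    exact T.unit_act f X

end Lift

end Polyad

section Comonoidal

open Functor.OplaxMonoidal

/-- A natural transformation between comonoidal (oplax monoidal) functors is *comonoidal*. -/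
structure IsComonoidal {C : Type u₁} {D : Type u₂} [Category.{v₁} C] [MonoidalCategory C]
    [Category.{v₂} D] [MonoidalCategory D] {F G : C ⥤ D} [F.OplaxMonoidal] [G.OplaxMonoidal]
    (τ : F ⟶ G) : Prop where
  app_unit : τ.app (𝟙_ C) ≫ η G = η F
  app_tensor : ∀ X Y : C, τ.app (X ⊗ Y) ≫ δ G X Y = δ F X Y ≫ (τ.app X ⊗ₘ τ.app Y)

/-- A monad whose underlying functor is comonoidal is a *comonoidal monad* if its product and unit
are comonoidal natural transformations. -/
class IsComonoidalMonad {C : Type u₁} [Category.{v₁} C] [MonoidalCategory C] (T : Monad C)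
    [T.toFunctor.OplaxMonoidal] : Prop where
  unit_comonoidal : IsComonoidal T.η
  mul_comonoidal : IsComonoidal T.μ

/-- A coalgebra `A` in a monoidal category is *transitive* if `A ⊗ ?` is conservative. -/
def IsTransitiveCoalgebra {C : Type u₁} [Category.{v₁} C] [MonoidalCategory C] (A : Comon C) :
    Prop :=
  (tensorLeft A.X).ReflectsIsomorphisms

section Monad

variable {C : Type u₁} [Category.{v₁} C] [MonoidalCategory C] (T : Monad C)
  [T.toFunctor.OplaxMonoidal] [IsComonoidalMonad T]

theorem monad_unit_tensor (X Y : C) :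
    T.η.app (X ⊗ Y) ≫ δ T.toFunctor X Y = T.η.app X ⊗ₘ T.η.app Y := by
  have := (IsComonoidalMonad.unit_comonoidal (T := T)).app_tensor X Y
  simpa using this

theorem monad_mul_tensor (X Y : C) :
    T.μ.app (X ⊗ Y) ≫ δ T.toFunctor X Y =
      T.map (δ T.toFunctor X Y) ≫ δ T.toFunctor (T.obj X) (T.obj Y) ≫
        (T.μ.app X ⊗ₘ T.μ.app Y) := by
  have := (IsComonoidalMonad.mul_comonoidal (T := T)).app_tensor X Y
  simpa using this

theorem monad_unit_unit : T.η.app (𝟙_ C) ≫ η T.toFunctor = 𝟙 (𝟙_ C) := by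
  have := (IsComonoidalMonad.unit_comonoidal (T := T)).app_unit
  simpa using this

theorem monad_mul_unit :
    T.μ.app (𝟙_ C) ≫ η T.toFunctor = T.map (η T.toFunctor) ≫ η T.toFunctor := by
  have := (IsComonoidalMonad.mul_comonoidal (T := T)).app_unit
  simpa using this


/-- The tensor product of two modules over a comonoidal monad. -/
@[reducible] def algebraTensor (X Y : T.Algebra) : T.Algebra where
  A := X.A ⊗ Y.A
  a := δ T.toFunctor X.A Y.A ≫ (X.a ⊗ₘ Y.a)
  unit := by
    rw [reassoc_of% monad_unit_tensor T, tensorHom_comp_tensorHom, X.unit, Y.unit, id_tensorHom_id]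
  assoc := by
    rw [reassoc_of% monad_mul_tensor T, tensorHom_comp_tensorHom, X.assoc, Y.assoc, Functor.map_comp,
      Category.assoc, ← δ_natural_assoc, tensorHom_comp_tensorHom]

/-- The unit object for modules over a comonoidal monad. -/
@[reducible] def algebraUnit : T.Algebra where
  A := 𝟙_ C
  a := η T.toFunctor
  unit := monad_unit_unit T
  assoc := monad_mul_unit T

/-- The tensor product of two module morphisms. -/
@[reducible] def algebraTensorHom {X Y X' Y' : T.Algebra} (f : X ⟶ Y) (g : X' ⟶ Y') :
    algebraTensor T X X' ⟶ algebraTensor T Y Y' where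
  f := f.f ⊗ₘ g.f
  h := by
    rw [← δ_natural_assoc, tensorHom_comp_tensorHom, f.h, g.h, Category.assoc,
      tensorHom_comp_tensorHom]

instance algebraMonoidalStruct : MonoidalCategoryStruct T.Algebra where
  tensorObj := algebraTensor T
  tensorHom f g := algebraTensorHom T f g
  whiskerLeft X _ _ g :=
    { f := X.A ◁ g.f
      h := by simpa using (algebraTensorHom T (𝟙 X) g).h }
  whiskerRight f Y :=
    { f := f.f ▷ Y.A
      h := by simpa using (algebraTensorHom T f (𝟙 Y)).h }
  tensorUnit := algebraUnit T
  associator X Y Z := Monad.Algebra.isoMk (α_ X.A Y.A Z.A) (by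
    have h := oplax_associativity T.toFunctor X.A Y.A Z.A
    have h' := congrArg (fun m => m ≫ (X.a ⊗ₘ (Y.a ⊗ₘ Z.a))) h
    simp only [Category.assoc] at h'
    change T.map (α_ X.A Y.A Z.A).hom ≫ δ T.toFunctor X.A (Y.A ⊗ Z.A) ≫
      (X.a ⊗ₘ (δ T.toFunctor Y.A Z.A ≫ (Y.a ⊗ₘ Z.a))) =
      (δ T.toFunctor (X.A ⊗ Y.A) Z.A ≫ ((δ T.toFunctor X.A Y.A ≫ (X.a ⊗ₘ Y.a)) ⊗ₘ Z.a)) ≫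
        (α_ X.A Y.A Z.A).hom
    rw [← whiskerLeft_comp_tensorHom, ← whiskerRight_comp_tensorHom]
    simp only [Category.assoc]
    rw [associator_naturality]
    exact h'.symm)
  leftUnitor X := Monad.Algebra.isoMk (λ_ X.A) (by
    have h := left_unitality_hom T.toFunctor X.A
    change T.map (λ_ X.A).hom ≫ X.a =
      (δ T.toFunctor (𝟙_ C) X.A ≫ (η T.toFunctor ⊗ₘ X.a)) ≫ (λ_ X.A).hom
    rw [MonoidalCategory.tensorHom_def, Category.assoc, Category.assoc, leftUnitor_naturality]
    rw [← h]
    simp)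
  rightUnitor X := Monad.Algebra.isoMk (ρ_ X.A) (by
    have h := right_unitality_hom T.toFunctor X.A
    change T.map (ρ_ X.A).hom ≫ X.a =
      (δ T.toFunctor X.A (𝟙_ C) ≫ (X.a ⊗ₘ η T.toFunctor)) ≫ (ρ_ X.A).hom
    rw [MonoidalCategory.tensorHom_def', Category.assoc, Category.assoc, rightUnitor_naturality]
    rw [← h]
    simp)

/-- The category of modules over a comonoidal monad is monoidal, and the forgetful functor is
strict monoidal. -/
instance algebraMonoidal : MonoidalCategory T.Algebra :=
  Monoidal.induced T.forget
    { μIso := fun _ _ => Iso.refl _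
      εIso := Iso.refl _
      whiskerLeft_eq := fun X _ _ f => by
        change X.A ◁ f.f = 𝟙 _ ≫ (X.A ◁ f.f) ≫ 𝟙 _
        simp
      whiskerRight_eq := fun f Y => by
        change f.f ▷ Y.A = 𝟙 _ ≫ (f.f ▷ Y.A) ≫ 𝟙 _
        simp
      tensorHom_eq := fun f g => by
        change f.f ⊗ₘ g.f = 𝟙 _ ≫ (f.f ⊗ₘ g.f) ≫ 𝟙 _
        simp
      associator_eq := fun X Y Z => by
        change (α_ X.A Y.A Z.A).hom = ((𝟙 _ ≫ (𝟙 _ ⊗ₘ 𝟙 _)) ≫ (α_ X.A Y.A Z.A).hom ≫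
          ((𝟙 _ ⊗ₘ 𝟙 _) ≫ 𝟙 _))
        simp
      leftUnitor_eq := fun X => by
        change (λ_ X.A).hom = (𝟙 _ ≫ (𝟙 _ ⊗ₘ 𝟙 _)) ≫ (λ_ X.A).hom
        simp
      rightUnitor_eq := fun X => by
        change (ρ_ X.A).hom = (𝟙 _ ≫ (𝟙 _ ⊗ₘ 𝟙 _)) ≫ (ρ_ X.A).hom
        simp }

end Monad

/-- A *comonoidal polyad*: a polyad on monoidal categories with comonoidal functors `T_f`, such that
the products and units are comonoidal natural transformations. -/
structure ComonoidalPolyad (D : Type u₁) [Category.{v₁} D] (C : D → Type u₂)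
    [∀ i, Category.{v₂} (C i)] [∀ i, MonoidalCategory (C i)] extends Polyad D C where
  oplax : ∀ {i j : D} (f : i ⟶ j), (map f).OplaxMonoidal
  mul_comonoidal : ∀ {i j k : D} (f : i ⟶ j) (g : j ⟶ k) (h : i ⟶ k) (w : f ≫ g = h),
    IsComonoidal (mul f g h w)
  unit_comonoidal : ∀ i : D, IsComonoidal (unit i)

attribute [instance] ComonoidalPolyad.oplax

namespace ComonoidalPolyad

variable {D : Type u₁} [Category.{v₁} D] {C : D → Type u₂} [∀ i, Category.{v₂} (C i)]
  [∀ i, MonoidalCategory (C i)] (T : ComonoidalPolyad D C)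

instance monadComonoidal (i : D) : IsComonoidalMonad (T.monad i) where
  unit_comonoidal := T.unit_comonoidal i
  mul_comonoidal := T.mul_comonoidal ..

theorem mul_tensor {i j k : D} (f : i ⟶ j) (g : j ⟶ k) (h : i ⟶ k) (w : f ≫ g = h) (X Y : C i) :
    (T.mul f g h w).app (X ⊗ Y) ≫ δ (T.map h) X Y =
      (T.map g).map (δ (T.map f) X Y) ≫ δ (T.map g) ((T.map f).obj X) ((T.map f).obj Y) ≫
        ((T.mul f g h w).app X ⊗ₘ (T.mul f g h w).app Y) := by
  have := (T.mul_comonoidal f g h w).app_tensor X Y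
  simpa using this

theorem mul_tensorUnit {i j k : D} (f : i ⟶ j) (g : j ⟶ k) (h : i ⟶ k) (w : f ≫ g = h) :
    (T.mul f g h w).app (𝟙_ (C i)) ≫ η (T.map h) =
      (T.map g).map (η (T.map f)) ≫ η (T.map g) := by
  have := (T.mul_comonoidal f g h w).app_unit
  simpa using this

theorem unit_tensor {i : D} (X Y : C i) :
    (T.unit i).app (X ⊗ Y) ≫ δ (T.map (𝟙 i)) X Y = (T.unit i).app X ⊗ₘ (T.unit i).app Y :=
  monad_unit_tensor (T.monad i) X Y

theorem unit_tensorUnit (i : D) :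
    (T.unit i).app (𝟙_ (C i)) ≫ η (T.map (𝟙 i)) = 𝟙 (𝟙_ (C i)) :=
  monad_unit_unit (T.monad i)

section Lift

variable [T.toPolyad.IsRExact]

/-- The comonoidal structure `T_f ⊙ (X ⊗ Y) ⟶ (T_f ⊙ X) ⊗ (T_f ⊙ Y)`, induced by that of `T_f`. -/
noncomputable def tensorδ {i j : D} (f : i ⟶ j) (X Y : T.LiftCat i) :
    T.tensorObj f (X ⊗ Y) ⟶ T.tensorObj f X ⊗ T.tensorObj f Y :=
  T.desc f (X ⊗ Y) (δ (T.map f) X.A Y.A ≫ (T.proj f X ⊗ₘ T.proj f Y)) (by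
    change (T.map f).map (δ (T.map (𝟙 i)) X.A Y.A ≫ (X.a ⊗ₘ Y.a)) ≫ _ =
      (T.mul (𝟙 i) f f (Category.id_comp f)).app (X.A ⊗ Y.A) ≫ _
    rw [reassoc_of% T.mul_tensor, tensorHom_comp_tensorHom, ← T.proj_condition f X,
      ← T.proj_condition f Y, Functor.map_comp_assoc, ← δ_natural_assoc,
      tensorHom_comp_tensorHom])

@[simp]
theorem proj_tensorδ {i j : D} (f : i ⟶ j) (X Y : T.LiftCat i) :
    T.proj f (X ⊗ Y) ≫ T.tensorδ f X Y =
      δ (T.map f) X.A Y.A ≫ (T.proj f X ⊗ₘ T.proj f Y) :=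
  T.proj_desc ..

/-- The comonoidal structure `T_f ⊙ 𝟙 ⟶ 𝟙`, induced by that of `T_f`. -/
noncomputable def tensorη {i j : D} (f : i ⟶ j) :
    T.tensorObj f (𝟙_ (T.LiftCat i)) ⟶ 𝟙_ (C j) :=
  T.desc f (𝟙_ (T.LiftCat i)) (η (T.map f)) (by
    change (T.map f).map (η (T.map (𝟙 i))) ≫ _ =
      (T.mul (𝟙 i) f f (Category.id_comp f)).app (𝟙_ (C i)) ≫ _
    rw [mul_tensorUnit])

@[simp]
theorem proj_tensorη {i j : D} (f : i ⟶ j) :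
    T.proj f (𝟙_ (T.LiftCat i)) ≫ T.tensorη f = η (T.map f) :=
  T.proj_desc ..

theorem act_tensorδ {i j k : D} (f : i ⟶ j) (g : j ⟶ k) (h : i ⟶ k) (w : f ≫ g = h)
    (X Y : T.LiftCat i) :
    T.act f g h w (X ⊗ Y) ≫ T.tensorδ h X Y =
      (T.map g).map (T.tensorδ f X Y) ≫ δ (T.map g) (T.tensorObj f X) (T.tensorObj f Y) ≫
        (T.act f g h w X ⊗ₘ T.act f g h w Y) := by
  rw [← cancel_epi ((T.map g).map (T.proj f (X ⊗ Y))), reassoc_of% T.map_proj_act,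
    proj_tensorδ, ← Functor.map_comp_assoc, proj_tensorδ, Functor.map_comp_assoc,
    ← δ_natural_assoc, tensorHom_comp_tensorHom, T.map_proj_act, T.map_proj_act,
    ← tensorHom_comp_tensorHom]
  exact (reassoc_of% (T.mul_tensor f g h w X.A Y.A)) _

theorem act_tensorη {i j k : D} (f : i ⟶ j) (g : j ⟶ k) (h : i ⟶ k) (w : f ≫ g = h) :
    T.act f g h w (𝟙_ (T.LiftCat i)) ≫ T.tensorη h =
      (T.map g).map (T.tensorη f) ≫ η (T.map g) := by
  rw [← cancel_epi ((T.map g).map (T.proj f (𝟙_ (T.LiftCat i)))), reassoc_of% T.map_proj_act,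
    proj_tensorη, ← Functor.map_comp_assoc, proj_tensorη]
  exact T.mul_tensorUnit ..

theorem tensorδ_natural_left {i j : D} (f : i ⟶ j) {X Y : T.LiftCat i} (φ : X ⟶ Y)
    (X' : T.LiftCat i) :
    T.tensorδ f X X' ≫ T.tensorMap f φ ▷ T.tensorObj f X' =
      T.tensorMap f (φ ▷ X') ≫ T.tensorδ f Y X' := by
  rw [← cancel_epi (T.proj f (X ⊗ X')), reassoc_of% T.proj_tensorδ, reassoc_of% T.proj_tensorMap, proj_tensorδ,
    tensorHom_comp_whiskerRight, T.proj_tensorMap, ← whiskerRight_comp_tensorHom]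
  exact δ_natural_left_assoc (T.map f) φ.f X'.A _

theorem tensorδ_natural_right {i j : D} (f : i ⟶ j) {X Y : T.LiftCat i} (X' : T.LiftCat i)
    (φ : X ⟶ Y) :
    T.tensorδ f X' X ≫ T.tensorObj f X' ◁ T.tensorMap f φ =
      T.tensorMap f (X' ◁ φ) ≫ T.tensorδ f X' Y := by
  rw [← cancel_epi (T.proj f (X' ⊗ X)), reassoc_of% T.proj_tensorδ, reassoc_of% T.proj_tensorMap, proj_tensorδ,
    tensorHom_comp_whiskerLeft, T.proj_tensorMap, ← whiskerLeft_comp_tensorHom]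
  exact δ_natural_right_assoc (T.map f) X'.A φ.f _

theorem tensorδ_assoc {i j : D} (f : i ⟶ j) (X Y Z : T.LiftCat i) :
    T.tensorδ f (X ⊗ Y) Z ≫ T.tensorδ f X Y ▷ T.tensorObj f Z ≫
        (α_ (T.tensorObj f X) (T.tensorObj f Y) (T.tensorObj f Z)).hom =
      T.tensorMap f (α_ X Y Z).hom ≫ T.tensorδ f X (Y ⊗ Z) ≫
        T.tensorObj f X ◁ T.tensorδ f Y Z := by
  rw [← cancel_epi (T.proj f ((X ⊗ Y) ⊗ Z)), reassoc_of% T.proj_tensorδ, reassoc_of% T.proj_tensorMap,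
    reassoc_of% T.proj_tensorδ, tensorHom_comp_whiskerLeft, proj_tensorδ,
    ← Category.assoc (_ ⊗ₘ _), tensorHom_comp_whiskerRight, proj_tensorδ,
    ← whiskerRight_comp_tensorHom, ← whiskerLeft_comp_tensorHom, Category.assoc,
    associator_naturality]
  have h := congrArg (fun m => m ≫ (T.proj f X ⊗ₘ (T.proj f Y ⊗ₘ T.proj f Z)))
    (oplax_associativity (T.map f) X.A Y.A Z.A)
  simp only [Category.assoc] at h
  exact h

theorem tensorδ_left_unit {i j : D} (f : i ⟶ j) (X : T.LiftCat i) :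
    (λ_ (T.tensorObj f X)).inv =
      T.tensorMap f (λ_ X).inv ≫ T.tensorδ f (𝟙_ (T.LiftCat i)) X ≫
        T.tensorη f ▷ T.tensorObj f X := by
  rw [← cancel_epi (T.proj f X), reassoc_of% T.proj_tensorMap, reassoc_of% T.proj_tensorδ,
    tensorHom_comp_whiskerRight, proj_tensorη, leftUnitor_inv_naturality,
    MonoidalCategory.tensorHom_def, oplax_left_unitality (T.map f) X.A]
  simp only [Category.assoc]
  rfl

theorem tensorδ_right_unit {i j : D} (f : i ⟶ j) (X : T.LiftCat i) :
    (ρ_ (T.tensorObj f X)).inv =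
      T.tensorMap f (ρ_ X).inv ≫ T.tensorδ f X (𝟙_ (T.LiftCat i)) ≫
        T.tensorObj f X ◁ T.tensorη f := by
  rw [← cancel_epi (T.proj f X), reassoc_of% T.proj_tensorMap, reassoc_of% T.proj_tensorδ,
    tensorHom_comp_whiskerLeft, proj_tensorη, rightUnitor_inv_naturality,
    MonoidalCategory.tensorHom_def', oplax_right_unitality (T.map f) X.A]
  simp only [Category.assoc]
  rfl

/-- The comonoidal structure of the lifted functor. -/
noncomputable instance liftOplax {i j : D} (f : i ⟶ j) :
    (T.toPolyad.liftMap f).OplaxMonoidal where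
  η := { f := T.tensorη f
         h := (T.act_tensorη ..).symm }
  δ X Y := { f := T.tensorδ f X Y
             h := ((T.act_tensorδ f (𝟙 j) f (Category.comp_id f) X Y).trans rfl).symm }
  δ_natural_left φ X' := Monad.Algebra.Hom.ext (T.tensorδ_natural_left f φ X')
  δ_natural_right X' φ := Monad.Algebra.Hom.ext (T.tensorδ_natural_right f X' φ)
  oplax_associativity X Y Z := Monad.Algebra.Hom.ext (T.tensorδ_assoc f X Y Z)
  oplax_left_unitality X := Monad.Algebra.Hom.ext (T.tensorδ_left_unit f X)
  oplax_right_unitality X := Monad.Algebra.Hom.ext (T.tensorδ_right_unit f X)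

theorem tensorMul_tensorδ {i j k : D} (f : i ⟶ j) (g : j ⟶ k) (h : i ⟶ k) (w : f ≫ g = h)
    (X Y : T.LiftCat i) :
    T.tensorMul f g h w (X ⊗ Y) ≫ T.tensorδ h X Y =
      (T.tensorMap g (δ (T.liftMap f) X Y) ≫ T.tensorδ g (T.liftObj f X) (T.liftObj f Y)) ≫
        (T.tensorMul f g h w X ⊗ₘ T.tensorMul f g h w Y) := by
  rw [← cancel_epi (T.proj g (T.liftObj f (X ⊗ Y))), reassoc_of% T.proj_tensorMul, Category.assoc,
    reassoc_of% T.proj_tensorMap, reassoc_of% T.proj_tensorδ, tensorHom_comp_tensorHom, T.proj_tensorMul,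
    T.proj_tensorMul]
  exact T.act_tensorδ f g h w X Y

theorem tensorMul_tensorη {i j k : D} (f : i ⟶ j) (g : j ⟶ k) (h : i ⟶ k) (w : f ≫ g = h) :
    T.tensorMul f g h w (𝟙_ (T.LiftCat i)) ≫ T.tensorη h =
      T.tensorMap g (η (T.liftMap f)) ≫ T.tensorη g := by
  rw [← cancel_epi (T.proj g (T.liftObj f (𝟙_ (T.LiftCat i)))), reassoc_of% T.proj_tensorMul,
    reassoc_of% T.proj_tensorMap, proj_tensorη]
  exact T.act_tensorη f g h w

/-- The lift of an r-exact comonoidal polyad is a comonoidal polyad. -/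
@[reducible] noncomputable def lift : ComonoidalPolyad D T.LiftCat where
  toPolyad := T.toPolyad.lift
  oplax f := T.liftOplax f
  mul_comonoidal f g h w :=
    { app_unit := Monad.Algebra.Hom.ext (T.tensorMul_tensorη f g h w)
      app_tensor := fun X Y => Monad.Algebra.Hom.ext (T.tensorMul_tensorδ f g h w X Y) }
  unit_comonoidal i :=
    { app_unit := Monad.Algebra.Hom.ext (by
        refine (Category.assoc _ _ _).trans ?_
        refine (congrArg _ (T.proj_tensorη (𝟙 i))).trans ?_
        exact T.unit_tensorUnit i)
      app_tensor := fun X Y => Monad.Algebra.Hom.ext (by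
        refine (Category.assoc _ _ _).trans ?_
        refine (congrArg _ (T.proj_tensorδ (𝟙 i) X Y)).trans ?_
        refine ((reassoc_of% (T.unit_tensor X.A Y.A)) _).trans ?_
        refine (tensorHom_comp_tensorHom _ _ _ _).trans ?_
        exact (Category.id_comp _).symm) }

end Lift

/-- A comonoidal polyad is *r-exact* if it is r-exact as a polyad and the tensor products of the
categories are r-exact in each variable. -/
class IsRExact : Prop extends Polyad.IsRExact T.toPolyad where
  rExact_tensorLeft : ∀ {i : D} (X : C i), RExact (tensorLeft X)
  rExact_tensorRight : ∀ {i : D} (X : C i), RExact (tensorRight X)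

/-- The coalgebra `T_f(𝟙)`, image of the trivial coalgebra under the comonoidal functor `T_f`. -/
noncomputable def unitCoalgebra {i j : D} (f : i ⟶ j) : Comon (C j) :=
  (T.map f).mapComon.obj (Comon.trivial (C i))

/-- A comonoidal polyad is *transitive* if all coalgebras `T_f(𝟙)` are transitive. -/
def IsTransitive : Prop :=
  ∀ {i j : D} (f : i ⟶ j), IsTransitiveCoalgebra (T.unitCoalgebra f)

/-- The left fusion operator `T_g(X ⊗ T_f Y) ⟶ T_g X ⊗ T_h Y`, for `h = g ∘ f`. -/
def leftFusion {i j k : D} (f : i ⟶ j) (g : j ⟶ k) (h : i ⟶ k) (w : f ≫ g = h)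
    (X : C j) (Y : C i) :
    (T.map g).obj (X ⊗ (T.map f).obj Y) ⟶ (T.map g).obj X ⊗ (T.map h).obj Y :=
  δ (T.map g) X ((T.map f).obj Y) ≫ ((T.map g).obj X ◁ (T.mul f g h w).app Y)

/-- The right fusion operator `T_g(T_f Y ⊗ X) ⟶ T_h Y ⊗ T_g X`, for `h = g ∘ f`. -/
def rightFusion {i j k : D} (f : i ⟶ j) (g : j ⟶ k) (h : i ⟶ k) (w : f ≫ g = h)
    (Y : C i) (X : C j) :
    (T.map g).obj ((T.map f).obj Y ⊗ X) ⟶ (T.map h).obj Y ⊗ (T.map g).obj X :=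
  δ (T.map g) ((T.map f).obj Y) X ≫ ((T.mul f g h w).app Y ▷ (T.map g).obj X)

/-- A *left Hopf polyad*: the left fusion operator is invertible. -/
def IsLeftHopf : Prop :=
  ∀ {i j k : D} (f : i ⟶ j) (g : j ⟶ k) (h : i ⟶ k) (w : f ≫ g = h) (X : C j) (Y : C i),
    IsIso (T.leftFusion f g h w X Y)

/-- A *right Hopf polyad*: the right fusion operator is invertible. -/
def IsRightHopf : Prop :=
  ∀ {i j k : D} (f : i ⟶ j) (g : j ⟶ k) (h : i ⟶ k) (w : f ≫ g = h) (Y : C i) (X : C j),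
    IsIso (T.rightFusion f g h w Y X)

/-- A comonoidal polyad is *strong comonoidal* if all comonoidal functors `T_f` are strong, that is,
preserve tensor products and tensor units. -/
def IsStrong : Prop :=
  ∀ {i j : D} (f : i ⟶ j), (∀ X Y : C i, IsIso (δ (T.map f) X Y)) ∧ IsIso (η (T.map f))

end ComonoidalPolyad

end Comonoidal

/-! Two facts combine. First, the Hopf property passes to the lift. Both sides of a lifted fusion
operator are quotients of the two sides of a fusion operator `H` of `T`, and `H` is compatible with
the projections (`proj_lift_leftFusion`). It remains to see that `inv H` descends too. By
r-exactness, the target is a quotient in each tensor variable separately, so there are two relations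
to check. The relation in the lower variable `Y` is preserved because fusion is natural and products
are associative. In `X`, the action on the source is diagonal while that on the target touches one
factor only; the fusion operator along an identity, itself invertible, converts one into the other
(`leftFusion_mul_left`, `map_leftFusion_a_proj`).

Second, the lifted units are invertible, since `T_i ⊙_{T_i} X` is `X`, and a Hopf polyad with
invertible units is nearly strong. Fusion along an identity shows that the coproducts `δ` are
invertible. Unitality then makes `T_f(A) ⊗ η` invertible, so `η` is invertible once some `T_f(A) ⊗
?` is conservative. Finally, fusion at `X = 𝟙` gives `T_g(𝟙) ⊗ μ` with `T_g(𝟙) ≅ 𝟙`, so `μ` is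
invertible.

For the lift, conservativity is tested on the free module `A = T_i 𝟙`: its image is `T_f 𝟙`, to
which transitivity of `T` applies directly. -/

/-! ### Tensor products of reflexive coequalizers. -/

section TensorCoequalizer

variable {V : Type u₁} [Category.{v₁} V] [MonoidalCategory V]
  {A B A' B' : V} (s t : A ⟶ B) (s' t' : A' ⟶ B') [IsReflexivePair s t] [IsReflexivePair s' t']
  [HasCoequalizer s t] [HasCoequalizer s' t']

theorem epi_coequalizer_π_whiskerRight [∀ X : V, RExact (tensorRight X)] (Y : V) :
    Epi (coequalizer.π s t ▷ Y) :=
  Cofork.IsColimit.epi (isColimitOfHasCoequalizerOfPreservesColimit (tensorRight Y) s t)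

theorem epi_whiskerLeft_coequalizer_π [∀ X : V, RExact (tensorLeft X)] (X : V) :
    Epi (X ◁ coequalizer.π s t) :=
  Cofork.IsColimit.epi (isColimitOfHasCoequalizerOfPreservesColimit (tensorLeft X) s t)

variable [∀ X : V, RExact (tensorLeft X)] [∀ X : V, RExact (tensorRight X)]

theorem epi_coequalizer_π_tensorHom : Epi (coequalizer.π s t ⊗ₘ coequalizer.π s' t') := by
  have := epi_coequalizer_π_whiskerRight s t B'
  have := epi_whiskerLeft_coequalizer_π s' t' (coequalizer s t)
  rw [MonoidalCategory.tensorHom_def]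
  exact epi_comp _ _

/-- A morphism out of a tensor product that coequalizes two reflexive pairs, one in each variable,
factors through the tensor product of their coequalizers. -/
theorem exists_coequalizer_π_tensorHom_comp_eq {Z : V} (m : B ⊗ B' ⟶ Z)
    (h : s ▷ B' ≫ m = t ▷ B' ≫ m) (h' : B ◁ s' ≫ m = B ◁ t' ≫ m) :
    ∃ d : coequalizer s t ⊗ coequalizer s' t' ⟶ Z,
      (coequalizer.π s t ⊗ₘ coequalizer.π s' t') ≫ d = m := by
  -- The two variables are divided out one after the other, each by r-exactness of tensoring with a
  -- fixed object.
  obtain ⟨m₁, hm₁⟩ := Cofork.IsColimit.desc'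
    (isColimitOfHasCoequalizerOfPreservesColimit (tensorRight B') s t) m h
  replace hm₁ : coequalizer.π s t ▷ B' ≫ m₁ = m := hm₁
  have hm₂ : coequalizer s t ◁ s' ≫ m₁ = coequalizer s t ◁ t' ≫ m₁ := by
    -- The second relation survives the first quotient: it can be tested after the epimorphism `π ▷
    -- A'`, where interchange reduces it to `h'`.
    have := epi_coequalizer_π_whiskerRight s t A'
    rw [← cancel_epi (coequalizer.π s t ▷ A'), ← whisker_exchange_assoc,
      ← whisker_exchange_assoc, hm₁, h']
  obtain ⟨m₂, hm₂⟩ := Cofork.IsColimit.desc'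
    (isColimitOfHasCoequalizerOfPreservesColimit (tensorLeft (coequalizer s t)) s' t') m₁ hm₂
  replace hm₂ : coequalizer s t ◁ coequalizer.π s' t' ≫ m₂ = m₁ := hm₂
  exact ⟨m₂, by rw [MonoidalCategory.tensorHom_def, Category.assoc, hm₂, hm₁]⟩

end TensorCoequalizer

/-- A morphism between quotients is invertible if it lifts to an invertible morphism whose inverse
descends. -/
theorem isIso_of_epi_of_inv_descends {V : Type u₁} [Category.{v₁} V] {A B A' B' : V} {p : A ⟶ A'}
    {q : B ⟶ B'} (hp : Epi p) (hq : Epi q) {H : A ⟶ B} [IsIso H] {Φ : A' ⟶ B'} (Ψ : B' ⟶ A')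
    (hΦ : p ≫ Φ = H ≫ q) (hΨ : q ≫ Ψ = inv H ≫ p) : IsIso Φ :=
  ⟨Ψ, by rw [← cancel_epi p, reassoc_of% hΦ, hΨ]; simp,
    by rw [← cancel_epi q, reassoc_of% hΨ, hΦ]; simp⟩

/-! ### Pseudofunctors, units of the lift, and free modules. -/

namespace Polyad

variable {D : Type u₁} [Category.{v₁} D] {C : D → Type u₂} [∀ i, Category.{v₂} (C i)]
  (T : Polyad D C)

/-- The lax functor defined by a polyad of action type is a pseudofunctor. -/
noncomputable def pseudoCoreOfIsActionType (hT : T.IsActionType) : T.toLaxFunctor.PseudoCore where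
  mapIdIso i :=
    haveI := hT.2 i.as
    (Cat.Hom.isoMk (asIso (T.unit i.as))).symm
  mapCompIso f g :=
    haveI := hT.1 f.as g.as _ rfl
    (Cat.Hom.isoMk (asIso (T.mul f.as g.as _ rfl))).symm
  mapIdIso_inv := rfl
  mapCompIso_inv _ _ := rfl

variable [T.IsRExact]

/-- The projection `T_i X ⟶ T_i ⊙_{T_i} X` exhibits `T_i ⊙_{T_i} X` as `X`, so that the lifted unit
is invertible. -/
instance isIso_lift_unit_app (i : D) (X : T.LiftCat i) : IsIso ((T.lift.unit i).app X) := by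
  have w : (T.map (𝟙 i)).map X.a ≫ X.a =
      (T.mul (𝟙 i) (𝟙 i) (𝟙 i) (Category.id_comp _)).app X.A ≫ X.a := X.assoc.symm
  have hu : (T.unit i).app X.A ≫ X.a = 𝟙 X.A := X.unit
  have h : IsIso ((T.unit i).app X.A ≫ T.proj (𝟙 i) X) := by
    -- The inverse is induced by the action, which is compatible with the coequalizer by
    -- associativity.
    refine ⟨T.desc (𝟙 i) X X.a w, ?_, ?_⟩
    · exact (Category.assoc _ _ _).trans ((congrArg _ (T.proj_desc ..)).trans hu)
    · rw [← cancel_epi (T.proj (𝟙 i) X), reassoc_of% T.proj_desc (𝟙 i) X X.a w,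
        reassoc_of% T.unit_naturality X.a, proj_condition, reassoc_of% T.unit_mul, Category.comp_id]
  have : IsIso ((T.monad i).forget.map ((T.lift.unit i).app X)) := h
  exact isIso_of_reflects_iso _ (T.monad i).forget

instance isIso_lift_unit (i : D) : IsIso (T.lift.unit i) :=
  NatIso.isIso_of_isIso_app _

/-- The free `T_i`-module on `N`. -/
@[reducible] def freeModule {i : D} (N : C i) : T.LiftCat i where
  A := (T.map (𝟙 i)).obj N
  a := (T.mul (𝟙 i) (𝟙 i) (𝟙 i) (Category.comp_id _)).app N
  unit := T.unit_mul ..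
  assoc := (T.mul_assoc ..).symm

/-- `T_f ⊙_{T_i} T_i N` is `T_f N`. -/
noncomputable def tensorObjFreeIso {i j : D} (f : i ⟶ j) (N : C i) :
    T.tensorObj f (T.freeModule N) ≅ (T.map f).obj N where
  hom := T.desc f (T.freeModule N) ((T.mul (𝟙 i) f f (Category.id_comp f)).app N)
    (T.mul_assoc ..)
  inv := (T.map f).map ((T.unit i).app N) ≫ T.proj f (T.freeModule N)
  hom_inv_id := by
    rw [← cancel_epi (T.proj f _)]
    refine ((Category.assoc _ _ _).symm.trans (congrArg (· ≫ _) (T.proj_desc ..))).trans ?_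
    refine (reassoc_of% (T.mul_naturality (𝟙 i) f f (Category.id_comp f) ((T.unit i).app N)).symm)
      (T.proj f (T.freeModule N)) |>.trans ?_
    -- In the quotient, the product on `T_f T_i (T_i N)` may be replaced by `T_f` of the action of
    -- the free module; that action cancels the unit inserted by `inv`.
    refine (congrArg _ (T.proj_condition f (T.freeModule N)).symm).trans ?_
    rw [← Functor.map_comp_assoc]
    refine (congrArg (· ≫ _) ((congrArg (T.map f).map (T.map_unit_mul (𝟙 i) N)).trans
      (CategoryTheory.Functor.map_id _ _))).trans ?_
    exact (Category.id_comp _).trans (Category.comp_id _).symm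
  inv_hom_id :=
    (Category.assoc _ _ _).trans ((congrArg _ (T.proj_desc ..)).trans (T.map_unit_mul f N))

end Polyad

open Functor.OplaxMonoidal

namespace ComonoidalPolyad

variable {D : Type u₁} [Category.{v₁} D] {C : D → Type u₂} [∀ i, Category.{v₂} (C i)]
  [∀ i, MonoidalCategory (C i)] (T : ComonoidalPolyad D C)

/-! ### Hopf polyads with invertible units. -/

section Hopf

/-- The unit law makes this product a one-sided inverse of `T_f(η)`, which is invertible here. -/
theorem isIso_mul_id [∀ i, IsIso (T.unit i)] {i j : D} (f : i ⟶ j) (X : C i) :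
    IsIso ((T.mul (𝟙 i) f f (Category.id_comp f)).app X) :=
  haveI : IsIso ((T.map f).map ((T.unit i).app X) ≫
      (T.mul (𝟙 i) f f (Category.id_comp f)).app X) := by
    rw [T.map_unit_mul]; exact IsIso.id _
  IsIso.of_isIso_comp_left ((T.map f).map ((T.unit i).app X)) _

variable {T}

/-- Fusion along `𝟙 i` is `δ` at `(X, T_i Y)` followed by an invertible product. Naturality along
the unit `Y ⟶ T_i Y`, an isomorphism, carries invertibility over to `(X, Y)`. -/
theorem IsLeftHopf.isIso_δ [∀ i, IsIso (T.unit i)] (hT : T.IsLeftHopf) {i j : D} (f : i ⟶ j)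
    (X Y : C i) : IsIso (δ (T.map f) X Y) := by
  have := T.isIso_mul_id f Y
  have h : IsIso (δ (T.map f) X _ ≫ (T.map f).obj X ◁ _) :=
    hT (𝟙 i) f f (Category.id_comp f) X Y
  have h₁ : IsIso (δ (T.map f) X ((T.map (𝟙 i)).obj Y)) := IsIso.of_isIso_comp_right _
    ((T.map f).obj X ◁ (T.mul (𝟙 i) f f (Category.id_comp f)).app Y)
  have h₂ := δ_natural_right (T.map f) X ((T.unit i).app Y)
  have : IsIso (δ (T.map f) X Y ≫ (T.map f).obj X ◁ (T.map f).map ((T.unit i).app Y)) := by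
    rw [show δ (T.map f) X Y ≫ _ = _ from h₂]; exact IsIso.comp_isIso
  exact IsIso.of_isIso_comp_right _ ((T.map f).obj X ◁ (T.map f).map ((T.unit i).app Y))

theorem IsRightHopf.isIso_δ (hT : T.IsRightHopf) [∀ i, IsIso (T.unit i)] {i j : D} (f : i ⟶ j)
    (X Y : C i) : IsIso (δ (T.map f) X Y) := by
  have := T.isIso_mul_id f X
  have h : IsIso (δ (T.map f) _ Y ≫ _ ▷ (T.map f).obj Y) :=
    hT (𝟙 i) f f (Category.id_comp f) X Y
  have h₁ : IsIso (δ (T.map f) ((T.map (𝟙 i)).obj X) Y) := IsIso.of_isIso_comp_right _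
    ((T.mul (𝟙 i) f f (Category.id_comp f)).app X ▷ (T.map f).obj Y)
  have h₂ := δ_natural_left (T.map f) ((T.unit i).app X) Y
  have : IsIso (δ (T.map f) X Y ≫ (T.map f).map ((T.unit i).app X) ▷ (T.map f).obj Y) := by
    rw [show δ (T.map f) X Y ≫ _ = _ from h₂]; exact IsIso.comp_isIso
  exact IsIso.of_isIso_comp_right _ ((T.map f).map ((T.unit i).app X) ▷ (T.map f).obj Y)

/-- If the coproducts `T_f^2` are invertible, then the counit `T_f^0` is invertible as soon as
`T_f(A) ⊗ ?` is conservative for some object `A`. -/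
theorem isIso_η_of_isIso_δ {i j : D} (f : i ⟶ j) (hδ : ∀ X Y : C i, IsIso (δ (T.map f) X Y))
    (A : C i) [(tensorLeft ((T.map f).obj A)).ReflectsIsomorphisms] : IsIso (η (T.map f)) := by
  -- Unitality expresses `T_f(ρ)` as `δ`, then `T_f(A) ◁ η`, then `ρ`; all but the middle factor are
  -- known to be invertible.
  have h := right_unitality_hom (T.map f) A
  have : IsIso (δ (T.map f) A (𝟙_ (C i)) ≫ (T.map f).obj A ◁ η (T.map f) ≫
      (ρ_ ((T.map f).obj A)).hom) := by
    rw [h]; infer_instance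
  have := IsIso.of_isIso_comp_left (δ (T.map f) A (𝟙_ (C i)))
    ((T.map f).obj A ◁ η (T.map f) ≫ (ρ_ ((T.map f).obj A)).hom)
  have : IsIso ((tensorLeft ((T.map f).obj A)).map (η (T.map f))) :=
    IsIso.of_isIso_comp_right ((T.map f).obj A ◁ η (T.map f)) (ρ_ ((T.map f).obj A)).hom
  exact isIso_of_reflects_iso _ (tensorLeft ((T.map f).obj A))

/-- At `X = 𝟙` the fusion operator is `δ` followed by `T_g(𝟙) ◁ μ`, and the invertible counit
identifies `T_g(𝟙)` with `𝟙`. -/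
theorem IsLeftHopf.isIso_mul (hT : T.IsLeftHopf) (hs : T.IsStrong) {i j k : D} (f : i ⟶ j)
    (g : j ⟶ k) (h : i ⟶ k) (w : f ≫ g = h) : IsIso (T.mul f g h w) := by
  have := (hs g).1
  have := (hs g).2
  refine @NatIso.isIso_of_isIso_app _ _ _ _ _ _ _ fun Y => ?_
  have hf : IsIso (δ (T.map g) (𝟙_ (C j)) _ ≫ (T.map g).obj (𝟙_ (C j)) ◁ _) :=
    hT f g h w (𝟙_ (C j)) Y
  have h₁ : IsIso ((T.map g).obj (𝟙_ (C j)) ◁ (T.mul f g h w).app Y) :=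
    IsIso.of_isIso_comp_left (δ (T.map g) (𝟙_ (C j)) _) _
  -- Interchange replaces the whiskering object `T_g(𝟙)` by `𝟙`, which the left unitor then removes.
  have h₂ := whisker_exchange (η (T.map g)) ((T.mul f g h w).app Y)
  have : IsIso (η (T.map g) ▷ _ ≫ 𝟙_ (C k) ◁ (T.mul f g h w).app Y) := by
    rw [← h₂]; exact IsIso.comp_isIso
  have := IsIso.of_isIso_comp_left (η (T.map g) ▷ _) (𝟙_ (C k) ◁ (T.mul f g h w).app Y)
  rw [id_whiskerLeft_symm ((T.mul f g h w).app Y)]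
  infer_instance

theorem IsRightHopf.isIso_mul (hT : T.IsRightHopf) (hs : T.IsStrong) {i j k : D} (f : i ⟶ j)
    (g : j ⟶ k) (h : i ⟶ k) (w : f ≫ g = h) : IsIso (T.mul f g h w) := by
  have := (hs g).1
  have := (hs g).2
  refine @NatIso.isIso_of_isIso_app _ _ _ _ _ _ _ fun Y => ?_
  have hf : IsIso (δ (T.map g) _ (𝟙_ (C j)) ≫ _ ▷ (T.map g).obj (𝟙_ (C j))) :=
    hT f g h w Y (𝟙_ (C j))
  have h₁ : IsIso ((T.mul f g h w).app Y ▷ (T.map g).obj (𝟙_ (C j))) :=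
    IsIso.of_isIso_comp_left (δ (T.map g) _ (𝟙_ (C j))) _
  have h₂ := whisker_exchange ((T.mul f g h w).app Y) (η (T.map g))
  have : IsIso (_ ◁ η (T.map g) ≫ (T.mul f g h w).app Y ▷ 𝟙_ (C k)) := by
    rw [h₂]; exact IsIso.comp_isIso
  have := IsIso.of_isIso_comp_left (_ ◁ η (T.map g)) ((T.mul f g h w).app Y ▷ 𝟙_ (C k))
  rw [whiskerRight_id_symm ((T.mul f g h w).app Y)]
  infer_instance

/-- A left or right Hopf polyad whose units are invertible, and such that for each `f` the functor
`T_f(A) ⊗ ?` is conservative for some `A`, is strong comonoidal and of action type. -/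
theorem isStrong_and_isActionType (hT : T.IsLeftHopf ∨ T.IsRightHopf) [∀ i, IsIso (T.unit i)]
    (A : ∀ i, C i)
    (hA : ∀ {i j : D} (f : i ⟶ j), (tensorLeft ((T.map f).obj (A i))).ReflectsIsomorphisms) :
    T.IsStrong ∧ T.IsActionType := by
  have hδ : ∀ {i j : D} (f : i ⟶ j) (X Y : C i), IsIso (δ (T.map f) X Y) := fun f X Y =>
    hT.elim (fun hT => hT.isIso_δ f X Y) fun hT => hT.isIso_δ f X Y
  -- Conservativity on the left serves both cases: the counit argument uses only `δ`, regardless of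
  -- the side of the Hopf condition.
  have hs : T.IsStrong := fun {i j} f =>
    haveI := hA f
    ⟨hδ f, isIso_η_of_isIso_δ f (hδ f) (A i)⟩
  exact ⟨hs, fun f g h w => hT.elim (fun hT => hT.isIso_mul hs f g h w)
    fun hT => hT.isIso_mul hs f g h w, inferInstance⟩

end Hopf

/-- If `T` is transitive, then `(T_f ⊙_{T_i} T_i 𝟙) ⊗ ?` is a conservative endofunctor of the
category of `T_j`-modules. -/
theorem IsTransitive.reflectsIsomorphisms_lift {T : ComonoidalPolyad D C} [T.toPolyad.IsRExact]
    (hT : T.IsTransitive) {i j : D} (f : i ⟶ j) :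
    (tensorLeft ((T.lift.map f).obj (T.freeModule (𝟙_ (C i))))).ReflectsIsomorphisms where
  reflects {X Y} φ hφ := by
    have : (tensorLeft (T.unitCoalgebra f).X).ReflectsIsomorphisms := hT f
    -- An isomorphism of underlying objects is enough, since the forgetful functor is strict
    -- monoidal and conservative.
    let e := T.tensorObjFreeIso f (𝟙_ (C i))
    have h₁ : IsIso ((T.monad j).forget.map
      ((tensorLeft ((T.lift.map f).obj (T.freeModule (𝟙_ (C i))))).map φ)) := inferInstance
    have h₂ : IsIso (T.tensorObj f (T.freeModule (𝟙_ (C i))) ◁ φ.f) := h₁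
    have h₃ : IsIso ((tensorLeft (T.unitCoalgebra f).X).map φ.f) := by
      change IsIso ((T.map f).obj (𝟙_ (C i)) ◁ φ.f)
      -- Conjugation by `e` turns tensoring with the image of the free module into tensoring with
      -- `T_f 𝟙`.
      have h := whisker_exchange e.inv φ.f
      rw [← IsIso.eq_comp_inv] at h
      rw [h]
      infer_instance
    have h₄ : IsIso ((T.monad j).forget.map φ) :=
      isIso_of_reflects_iso φ.f (tensorLeft (T.unitCoalgebra f).X)
    exact isIso_of_reflects_iso φ (T.monad j).forget

/-! ### Compatibility of fusion operators with morphisms and products. -/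

section Fusion

variable {i j k : D} (f : i ⟶ j) (g : j ⟶ k) (h : i ⟶ k) (w : f ≫ g = h)

theorem leftFusion_natural_left {X X' : C j} (φ : X ⟶ X') (Y : C i) :
    (T.map g).map (φ ▷ (T.map f).obj Y) ≫ T.leftFusion f g h w X' Y =
      T.leftFusion f g h w X Y ≫ (T.map g).map φ ▷ (T.map h).obj Y := by
  simp only [leftFusion, Category.assoc, whisker_exchange]
  exact (δ_natural_left_assoc ..).symm

theorem leftFusion_natural_right (X : C j) {Y Y' : C i} (ψ : Y ⟶ Y') :
    (T.map g).map (X ◁ (T.map f).map ψ) ≫ T.leftFusion f g h w X Y' =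
      T.leftFusion f g h w X Y ≫ (T.map g).obj X ◁ (T.map h).map ψ := by
  simp only [leftFusion, Category.assoc, ← whiskerLeft_comp]
  rw [← δ_natural_right_assoc, ← whiskerLeft_comp, T.mul_naturality]

/-- By associativity, fusion respects the product maps in `Y`. With `leftFusion_natural_right`, it
matches both arrows of the pairs defining `T_f ⊙ Y` and `T_h ⊙ Y`. -/
theorem leftFusion_mul_right (X : C j) (Y : C i) :
    (T.map g).map (X ◁ (T.mul (𝟙 i) f f (Category.id_comp f)).app Y) ≫ T.leftFusion f g h w X Y =
      T.leftFusion f g h w X ((T.map (𝟙 i)).obj Y) ≫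
        (T.map g).obj X ◁ (T.mul (𝟙 i) h h (Category.id_comp h)).app Y := by
  simp only [leftFusion, Category.assoc, ← whiskerLeft_comp]
  rw [← δ_natural_right_assoc, ← whiskerLeft_comp,
    T.mul_assoc (𝟙 i) f g f h h (Category.id_comp f) w w (Category.id_comp h)]
  rfl

/-- Follows from comonoidality of the product and associativity. The inner fusion along `𝟙 j`
accounts for `T_j` being distributed over both factors `X` and `T_f Y`, whereas on the right-hand
factor of the target it is absorbed into `T_h Y`. -/
theorem leftFusion_mul_left (X : C j) (Y : C i) :
    (T.map g).map (T.leftFusion f (𝟙 j) f (Category.comp_id f) X Y) ≫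
        T.leftFusion f g h w ((T.map (𝟙 j)).obj X) Y ≫
        (T.mul (𝟙 j) g g (Category.id_comp g)).app X ▷ (T.map h).obj Y =
      (T.mul (𝟙 j) g g (Category.id_comp g)).app (X ⊗ (T.map f).obj Y) ≫
        T.leftFusion f g h w X Y := by
  simp only [leftFusion, Category.assoc, Functor.map_comp]
  rw [reassoc_of% T.mul_tensor, ← δ_natural_right_assoc, ← whiskerLeft_comp_assoc,
    T.mul_assoc f (𝟙 j) g f g h (Category.comp_id f) (Category.id_comp g) w w, ← tensorHom_def',
    tensorHom_comp_whiskerLeft]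

theorem rightFusion_natural_left {Y Y' : C i} (ψ : Y ⟶ Y') (X : C j) :
    (T.map g).map ((T.map f).map ψ ▷ X) ≫ T.rightFusion f g h w Y' X =
      T.rightFusion f g h w Y X ≫ (T.map h).map ψ ▷ (T.map g).obj X := by
  simp only [rightFusion, Category.assoc, ← comp_whiskerRight]
  rw [← δ_natural_left_assoc, ← comp_whiskerRight, T.mul_naturality]

theorem rightFusion_natural_right (Y : C i) {X X' : C j} (φ : X ⟶ X') :
    (T.map g).map ((T.map f).obj Y ◁ φ) ≫ T.rightFusion f g h w Y X' =
      T.rightFusion f g h w Y X ≫ (T.map h).obj Y ◁ (T.map g).map φ := by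
  simp only [rightFusion, Category.assoc, ← whisker_exchange]
  exact (δ_natural_right_assoc ..).symm

theorem rightFusion_mul_left (Y : C i) (X : C j) :
    (T.map g).map ((T.mul (𝟙 i) f f (Category.id_comp f)).app Y ▷ X) ≫ T.rightFusion f g h w Y X =
      T.rightFusion f g h w ((T.map (𝟙 i)).obj Y) X ≫
        (T.mul (𝟙 i) h h (Category.id_comp h)).app Y ▷ (T.map g).obj X := by
  simp only [rightFusion, Category.assoc, ← comp_whiskerRight]
  rw [← δ_natural_left_assoc, ← comp_whiskerRight,
    T.mul_assoc (𝟙 i) f g f h h (Category.id_comp f) w w (Category.id_comp h)]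
  rfl

/-- Mirror image of `leftFusion_mul_left`: the product in `X` is matched with the product on the
whole tensor product. -/
theorem rightFusion_mul_right (Y : C i) (X : C j) :
    (T.map g).map (T.rightFusion f (𝟙 j) f (Category.comp_id f) Y X) ≫
        T.rightFusion f g h w Y ((T.map (𝟙 j)).obj X) ≫
        (T.map h).obj Y ◁ (T.mul (𝟙 j) g g (Category.id_comp g)).app X =
      (T.mul (𝟙 j) g g (Category.id_comp g)).app ((T.map f).obj Y ⊗ X) ≫
        T.rightFusion f g h w Y X := by
  simp only [rightFusion, Category.assoc, Functor.map_comp]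
  rw [reassoc_of% T.mul_tensor, ← δ_natural_left_assoc, ← comp_whiskerRight_assoc,
    T.mul_assoc f (𝟙 j) g f g h (Category.comp_id f) (Category.id_comp g) w w,
    ← MonoidalCategory.tensorHom_def, tensorHom_comp_whiskerRight]
  rfl

end Fusion

/-! ### Descent of fusion operators and their inverses to the lift. -/

section LiftHopf

variable [T.IsRExact]

theorem epi_proj_tensorHom_proj {i j k : D} (f : i ⟶ k) (g : j ⟶ k) (X : T.LiftCat i)
    (Y : T.LiftCat j) : Epi (T.proj f X ⊗ₘ T.proj g Y) :=
  haveI : ∀ X : C k, RExact (tensorLeft X) := IsRExact.rExact_tensorLeft (T := T)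
  haveI : ∀ X : C k, RExact (tensorRight X) := IsRExact.rExact_tensorRight (T := T)
  epi_coequalizer_π_tensorHom _ _ _ _

theorem exists_proj_tensorHom_proj_comp_eq {i j k : D} (f : i ⟶ k) (g : j ⟶ k) (X : T.LiftCat i)
    (Y : T.LiftCat j) {Z : C k} (m : (T.map f).obj X.A ⊗ (T.map g).obj Y.A ⟶ Z)
    (h : (T.map f).map X.a ▷ (T.map g).obj Y.A ≫ m =
      (T.mul (𝟙 i) f f (Category.id_comp f)).app X.A ▷ (T.map g).obj Y.A ≫ m)
    (h' : (T.map f).obj X.A ◁ (T.map g).map Y.a ≫ m =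
      (T.map f).obj X.A ◁ (T.mul (𝟙 j) g g (Category.id_comp g)).app Y.A ≫ m) :
    ∃ d : T.tensorObj f X ⊗ T.tensorObj g Y ⟶ Z, (T.proj f X ⊗ₘ T.proj g Y) ≫ d = m :=
  haveI : ∀ X : C k, RExact (tensorLeft X) := IsRExact.rExact_tensorLeft (T := T)
  haveI : ∀ X : C k, RExact (tensorRight X) := IsRExact.rExact_tensorRight (T := T)
  exists_coequalizer_π_tensorHom_comp_eq _ _ _ _ m h h'

/-- Tensoring with `X` preserves the defining coequalizer and keeps the pair reflexive, so `T_g`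
preserves it in turn. -/
theorem epi_whiskerLeft_proj {i j k : D} (f : i ⟶ j) (g : j ⟶ k) (X : C j) (Y : T.LiftCat i) :
    Epi ((T.map g).map (X ◁ T.proj f Y)) := by
  have : RExact (tensorLeft X) := IsRExact.rExact_tensorLeft (T := T) X
  have : IsReflexivePair ((tensorLeft X).map ((T.map f).map Y.a))
      ((tensorLeft X).map ((T.mul (𝟙 i) f f (Category.id_comp f)).app Y.A)) :=
    IsReflexivePair.mk' (X ◁ commonSection ((T.map f).map Y.a)
      ((T.mul (𝟙 i) f f (Category.id_comp f)).app Y.A))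
      ((whiskerLeft_comp _ _ _).symm.trans
        ((congrArg _ (section_comp_left _ _)).trans (whiskerLeft_id _ _)))
      ((whiskerLeft_comp _ _ _).symm.trans
        ((congrArg _ (section_comp_right _ _)).trans (whiskerLeft_id _ _)))
  exact Cofork.IsColimit.epi (isColimitCoforkMapOfIsColimit (T.map g) _
    (isColimitOfHasCoequalizerOfPreservesColimit (tensorLeft X) ((T.map f).map Y.a)
      ((T.mul (𝟙 i) f f (Category.id_comp f)).app Y.A)))

theorem epi_proj_whiskerRight {i j k : D} (f : i ⟶ j) (g : j ⟶ k) (Y : T.LiftCat i) (X : C j) :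
    Epi ((T.map g).map (T.proj f Y ▷ X)) := by
  have : RExact (tensorRight X) := IsRExact.rExact_tensorRight (T := T) X
  have : IsReflexivePair ((tensorRight X).map ((T.map f).map Y.a))
      ((tensorRight X).map ((T.mul (𝟙 i) f f (Category.id_comp f)).app Y.A)) :=
    IsReflexivePair.mk' (commonSection ((T.map f).map Y.a)
      ((T.mul (𝟙 i) f f (Category.id_comp f)).app Y.A) ▷ X)
      ((comp_whiskerRight _ _ _).symm.trans
        ((congrArg (· ▷ X) (section_comp_left _ _)).trans (id_whiskerRight _ _)))
      ((comp_whiskerRight _ _ _).symm.trans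
        ((congrArg (· ▷ X) (section_comp_right _ _)).trans (id_whiskerRight _ _)))
  exact Cofork.IsColimit.epi (isColimitCoforkMapOfIsColimit (T.map g) _
    (isColimitOfHasCoequalizerOfPreservesColimit (tensorRight X) ((T.map f).map Y.a)
      ((T.mul (𝟙 i) f f (Category.id_comp f)).app Y.A)))

section

variable {i j k : D} (f : i ⟶ j) (g : j ⟶ k) (h : i ⟶ k) (w : f ≫ g = h)

/-- The left fusion operator of the lift is induced by that of `T`. -/
theorem proj_lift_leftFusion (X : T.LiftCat j) (Y : T.LiftCat i) :
    ((T.map g).map (X.A ◁ T.proj f Y) ≫ T.proj g (X ⊗ T.liftObj f Y)) ≫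
        (T.lift.leftFusion f g h w X Y).f =
      T.leftFusion f g h w X.A Y.A ≫ (T.proj g X ⊗ₘ T.proj h Y) := by
  change _ ≫ (T.tensorδ g X (T.liftObj f Y) ≫ T.tensorObj g X ◁ T.tensorMul f g h w Y) = _
  rw [Category.assoc, reassoc_of% T.proj_tensorδ, tensorHom_comp_whiskerLeft, T.proj_tensorMul]
  refine (δ_natural_right_assoc (T.map g) X.A (T.proj f Y) _).symm.trans ?_
  rw [whiskerLeft_comp_tensorHom, T.map_proj_act, leftFusion, Category.assoc,
    whiskerLeft_comp_tensorHom]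

/-- Restricted along `X ⊗ T_f Y ⟶ X ⊗ (T_f ⊙ Y)`, the diagonal `T_j`-action is fusion along `𝟙 j`
followed by the action on `X` alone. The identity is thus the coequalizer relation for the module `X
⊗ (T_f ⊙ Y)`. -/
theorem map_leftFusion_a_proj (X : T.LiftCat j) (Y : T.LiftCat i) :
    (T.map g).map (T.leftFusion f (𝟙 j) f (Category.comp_id f) X.A Y.A) ≫
        (T.map g).map (X.a ▷ (T.map f).obj Y.A) ≫
        (T.map g).map (X.A ◁ T.proj f Y) ≫ T.proj g (X ⊗ T.liftObj f Y) =
      (T.mul (𝟙 j) g g (Category.id_comp g)).app (X.A ⊗ (T.map f).obj Y.A) ≫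
        (T.map g).map (X.A ◁ T.proj f Y) ≫ T.proj g (X ⊗ T.liftObj f Y) := by
  rw [← reassoc_of% T.mul_naturality]
  have hc := T.proj_condition g (X ⊗ T.liftObj f Y)
  change (T.map g).map (δ (T.map (𝟙 j)) X.A (T.tensorObj f Y) ≫
    (X.a ⊗ₘ T.act f (𝟙 j) f (Category.comp_id f) Y)) ≫ _ =
    (T.mul (𝟙 j) g g (Category.id_comp g)).app (X.A ⊗ T.tensorObj f Y) ≫ _ at hc
  rw [← hc, ← Functor.map_comp_assoc, ← Functor.map_comp_assoc, ← Functor.map_comp_assoc,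
    ← δ_natural_right_assoc, whiskerLeft_comp_tensorHom, T.map_proj_act, leftFusion,
    Category.assoc, Category.assoc, ← MonoidalCategory.tensorHom_def, whiskerLeft_comp_tensorHom]

/-- The lift of a left Hopf polyad is a left Hopf polyad. -/
theorem isIso_lift_leftFusion (hT : T.IsLeftHopf) (X : T.LiftCat j) (Y : T.LiftCat i) :
    IsIso (T.lift.leftFusion f g h w X Y) := by
  have hH := fun (X : C j) (Y : C i) => hT f g h w X Y
  have := hT f (𝟙 j) f (Category.comp_id f) X.A Y.A
  have hH₂ := hH ((T.map (𝟙 j)).obj X.A) Y.A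
  have hH₃ := hH X.A Y.A
  have hH₄ := hH X.A ((T.map (𝟙 i)).obj Y.A)
  -- `Ψ` is the map induced by the inverse fusion operator of `T`; the two obligations are its
  -- relations in `X` and in `Y`.
  obtain ⟨Ψ, hΨ⟩ := T.exists_proj_tensorHom_proj_comp_eq g h X Y
    (inv (T.leftFusion f g h w X.A Y.A) ≫ (T.map g).map (X.A ◁ T.proj f Y) ≫
      T.proj g (X ⊗ T.liftObj f Y))
    (by
      -- Precomposition with two invertible fusion operators moves the relation to `T_g T_j (X ⊗ T_f
      -- Y)`, where it is the one for the diagonal action.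
      rw [← cancel_epi (T.leftFusion f g h w ((T.map (𝟙 j)).obj X.A) Y.A),
        ← cancel_epi ((T.map g).map (T.leftFusion f (𝟙 j) f (Category.comp_id f) X.A Y.A)),
        reassoc_of% T.leftFusion_mul_left f g h w X.A Y.A, IsIso.hom_inv_id_assoc,
        ← reassoc_of% T.leftFusion_natural_left f g h w X.a Y.A, IsIso.hom_inv_id_assoc]
      exact T.map_leftFusion_a_proj f g X Y)
    (by
      -- Both arrows commute with fusion, which reduces this relation to the one defining `T_f ⊙ Y`,
      -- whiskered by `X` and mapped by `T_g`.
      rw [← cancel_epi (T.leftFusion f g h w X.A ((T.map (𝟙 i)).obj Y.A)),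
        ← reassoc_of% T.leftFusion_mul_right f g h w X.A Y.A, IsIso.hom_inv_id_assoc,
        ← reassoc_of% T.leftFusion_natural_right f g h w X.A Y.a, IsIso.hom_inv_id_assoc,
        ← Functor.map_comp_assoc, ← Functor.map_comp_assoc, ← whiskerLeft_comp,
        ← whiskerLeft_comp, T.proj_condition])
  have := T.epi_whiskerLeft_proj f g X.A Y
  have hp : Epi ((T.map g).map (X.A ◁ T.proj f Y) ≫ T.proj g (X ⊗ T.liftObj f Y)) :=
    epi_comp' ‹_› (T.epi_proj _ _)
  have : IsIso ((T.monad k).forget.map (T.lift.leftFusion f g h w X Y)) :=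
    isIso_of_epi_of_inv_descends hp (T.epi_proj_tensorHom_proj g h X Y) Ψ
      (T.proj_lift_leftFusion f g h w X Y) hΨ
  exact isIso_of_reflects_iso _ (T.monad k).forget

/-- The right fusion operator of the lift is induced by that of `T`. -/
theorem proj_lift_rightFusion (Y : T.LiftCat i) (X : T.LiftCat j) :
    ((T.map g).map (T.proj f Y ▷ X.A) ≫ T.proj g (T.liftObj f Y ⊗ X)) ≫
        (T.lift.rightFusion f g h w Y X).f =
      T.rightFusion f g h w Y.A X.A ≫ (T.proj h Y ⊗ₘ T.proj g X) := by
  change _ ≫ (T.tensorδ g (T.liftObj f Y) X ≫ T.tensorMul f g h w Y ▷ T.tensorObj g X) = _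
  rw [Category.assoc, reassoc_of% T.proj_tensorδ, tensorHom_comp_whiskerRight, T.proj_tensorMul]
  refine (δ_natural_left_assoc (T.map g) (T.proj f Y) X.A _).symm.trans ?_
  rw [whiskerRight_comp_tensorHom, T.map_proj_act, rightFusion, Category.assoc,
    whiskerRight_comp_tensorHom]

theorem map_rightFusion_a_proj (Y : T.LiftCat i) (X : T.LiftCat j) :
    (T.map g).map (T.rightFusion f (𝟙 j) f (Category.comp_id f) Y.A X.A) ≫
        (T.map g).map ((T.map f).obj Y.A ◁ X.a) ≫
        (T.map g).map (T.proj f Y ▷ X.A) ≫ T.proj g (T.liftObj f Y ⊗ X) =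
      (T.mul (𝟙 j) g g (Category.id_comp g)).app ((T.map f).obj Y.A ⊗ X.A) ≫
        (T.map g).map (T.proj f Y ▷ X.A) ≫ T.proj g (T.liftObj f Y ⊗ X) := by
  rw [← reassoc_of% T.mul_naturality]
  have hc := T.proj_condition g (T.liftObj f Y ⊗ X)
  change (T.map g).map (δ (T.map (𝟙 j)) (T.tensorObj f Y) X.A ≫
    (T.act f (𝟙 j) f (Category.comp_id f) Y ⊗ₘ X.a)) ≫ _ =
    (T.mul (𝟙 j) g g (Category.id_comp g)).app (T.tensorObj f Y ⊗ X.A) ≫ _ at hc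
  rw [← hc, ← Functor.map_comp_assoc, ← Functor.map_comp_assoc, ← Functor.map_comp_assoc,
    ← δ_natural_left_assoc, whiskerRight_comp_tensorHom, T.map_proj_act, rightFusion,
    Category.assoc, Category.assoc, ← MonoidalCategory.tensorHom_def',
    whiskerRight_comp_tensorHom]

/-- The lift of a right Hopf polyad is a right Hopf polyad. -/
theorem isIso_lift_rightFusion (hT : T.IsRightHopf) (Y : T.LiftCat i) (X : T.LiftCat j) :
    IsIso (T.lift.rightFusion f g h w Y X) := by
  have hH := fun (Y : C i) (X : C j) => hT f g h w Y X
  have := hT f (𝟙 j) f (Category.comp_id f) Y.A X.A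
  have hH₂ := hH Y.A ((T.map (𝟙 j)).obj X.A)
  have hH₃ := hH Y.A X.A
  have hH₄ := hH ((T.map (𝟙 i)).obj Y.A) X.A
  obtain ⟨Ψ, hΨ⟩ := T.exists_proj_tensorHom_proj_comp_eq h g Y X
    (inv (T.rightFusion f g h w Y.A X.A) ≫ (T.map g).map (T.proj f Y ▷ X.A) ≫
      T.proj g (T.liftObj f Y ⊗ X))
    (by
      rw [← cancel_epi (T.rightFusion f g h w ((T.map (𝟙 i)).obj Y.A) X.A),
        ← reassoc_of% T.rightFusion_mul_left f g h w Y.A X.A, IsIso.hom_inv_id_assoc,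
        ← reassoc_of% T.rightFusion_natural_left f g h w Y.a X.A, IsIso.hom_inv_id_assoc,
        ← Functor.map_comp_assoc, ← Functor.map_comp_assoc, ← comp_whiskerRight,
        ← comp_whiskerRight, T.proj_condition])
    (by
      -- As on the left, fusion along `𝟙 j` exchanges the action on `X` for the diagonal one.
      rw [← cancel_epi (T.rightFusion f g h w Y.A ((T.map (𝟙 j)).obj X.A)),
        ← cancel_epi ((T.map g).map (T.rightFusion f (𝟙 j) f (Category.comp_id f) Y.A X.A)),
        reassoc_of% T.rightFusion_mul_right f g h w Y.A X.A, IsIso.hom_inv_id_assoc,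
        ← reassoc_of% T.rightFusion_natural_right f g h w Y.A X.a, IsIso.hom_inv_id_assoc]
      exact T.map_rightFusion_a_proj f g Y X)
  have := T.epi_proj_whiskerRight f g Y X.A
  have hp : Epi ((T.map g).map (T.proj f Y ▷ X.A) ≫ T.proj g (T.liftObj f Y ⊗ X)) :=
    epi_comp' ‹_› (T.epi_proj _ _)
  have : IsIso ((T.monad k).forget.map (T.lift.rightFusion f g h w Y X)) :=
    isIso_of_epi_of_inv_descends hp (T.epi_proj_tensorHom_proj h g Y X) Ψ
      (T.proj_lift_rightFusion f g h w Y X) hΨ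
  exact isIso_of_reflects_iso _ (T.monad k).forget

end

end LiftHopf
end ComonoidalPolyad

theorem mainTheorem1 {D : Type u₁} [Category.{v₁} D] {C : D → Type u₂} [∀ i, Category.{v₂} (C i)]
    [∀ i, MonoidalCategory (C i)] (T : ComonoidalPolyad D C) [T.IsRExact]
    (hHopf : T.IsLeftHopf ∨ T.IsRightHopf) (hT : T.IsTransitive) :
    T.lift.IsStrong ∧ T.lift.IsActionType ∧ Nonempty T.lift.toLaxFunctor.PseudoCore := by
  have hlift : T.lift.IsLeftHopf ∨ T.lift.IsRightHopf :=
    hHopf.imp (fun hl _ _ _ f g h w X Y => T.isIso_lift_leftFusion f g h w hl X Y)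
      (fun hr _ _ _ f g h w Y X => T.isIso_lift_rightFusion f g h w hr Y X)
  have hu : ∀ i, IsIso (T.lift.unit i) := T.toPolyad.isIso_lift_unit
  obtain ⟨hs, ha⟩ := ComonoidalPolyad.isStrong_and_isActionType hlift
    -- The free module is used instead of the unit module `𝟙`, whose image is a priori only a
    -- quotient of `T_f 𝟙`.
    (fun i => T.freeModule (𝟙_ (C i))) (fun f => hT.reflectsIsomorphisms_lift f)
  exact ⟨hs, ha, ⟨T.lift.pseudoCoreOfIsActionType ha⟩⟩
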